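/- Let $dz$ denote normalized Lebesgue measure on the circle $S^1=\{z\in\mathbb C:|z|=1\}$. For $j=1,2,\dots$ let $$P_j(z)=\sum_{i=0}^{m_j-1}\epsilon_{i,j}\sqrt{p_{i,j}}\,z^{R_{i,j}},$$ where $m_j\ge 1$, the $p_{i,j}$ are positive with $\sum_i p_{i,j}=1$, the $\epsilon_{i,j}$ are complex numbers of absolute value $1$, and $R_{0,j}=0,R_{1,j},\dots,R_{m_j-1,j}$ are distinct non-negative integers; thus $\|P_j\|_{L^2(S^1,dz)}=1$. On $S^1$ write $$|P_j(z)|^2=1+\sum_{-N_j\le k\le N_j,\;k\ne0}a_{k,j}\,z^{n_{k,j}},$$ where the $n_{k,j}$ are distinct nonzero integers, each of the form $R_{l,j}-R_{i,j}$, with $n_{-k,j}=-n_{k,j}$ and $a_{-k,j}=\overline{a_{k,j}}$ (an $a_{k,j}$ may be $0$ if terms cancel). Put $$L_j=\sum_{k}a_{k,j}=|P_j(1)|^2-1,\qquad X_j(k)=z^{n_{k,j}}-\overline{a_{k,j}},\qquad m_j(k,l)=\int_{S^1}X_j(k)\,\overline{X_j(l)}\,|P_j(z)|^2\,dz,$$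 and let $r_j=\sum_{k,l}m_j(k,l)$ (a real number) be the sum of all the entries of the correlation matrix $(m_j(k,l))_{-N_j\le k,l\le N_j;\;k,l\ne0}$. Suppose that $L_j\neq0$ for all $j$ (this forces $N_j\ge1$), that the sequence $N_j/L_j^2$ is bounded, and that $\lim_{j\to\infty}|P_j(z)|=1$ for almost every $z\in S^1$. Then $r_j/N_j\to\infty$ as $j\to\infty$. -/

import Mathlib

open MeasureTheory Filter Topology
open scoped ComplexConjugate

/-- The Borel σ-algebra on the circle group `S¹ = {z ∈ ℂ : |z| = 1}`. -/
noncomputable instance circleMeasurableSpace : MeasurableSpace Circle := borel Circle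

instance circleBorelSpace : BorelSpace Circle := ⟨rfl⟩

/-- The normalized Lebesgue measure `dz` on `S¹`: the Haar measure of total mass `1`. -/
noncomputable def dz : Measure Circle := Measure.haarMeasure ⊤

/-- A polynomial `P(z) = ε₀ √p₀ + ε₁ √p₁ z ^ R₁ + ⋯ + ε_{m-1} √p_{m-1} z ^ R_{m-1}`, with `m ≥ 1`
terms, where the `pᵢ` are positive with sum `1`, the `εᵢ` are unimodular complex numbers, and the
exponents `R₀ = 0, R₁, …, R_{m-1}` are distinct natural numbers. -/
structure UnitPolynomial where
  /-- the number of terms -/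
  m : ℕ
  m_pos : 0 < m
  /-- the squared moduli of the coefficients -/
  p : Fin m → ℝ
  p_pos : ∀ i, 0 < p i
  p_sum : ∑ i, p i = 1
  /-- the phases of the coefficients -/
  ε : Fin m → ℂ
  norm_ε : ∀ i, ‖ε i‖ = 1
  /-- the exponents -/
  R : Fin m → ℕ
  R_zero : R ⟨0, m_pos⟩ = 0
  R_injective : Function.Injective R

namespace UnitPolynomial

/-- The value `P(z)` at a point of the circle. -/
noncomputable def eval (P : UnitPolynomial) (z : Circle) : ℂ :=
  ∑ i, P.ε i * (Real.sqrt (P.p i) : ℂ) * (z : ℂ) ^ P.R i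

/-- The index set `{k : -N ≤ k ≤ N, k ≠ 0}`. -/
noncomputable def idx (N : ℕ) : Finset ℤ := (Finset.Icc (-(N : ℤ)) (N : ℤ)).erase 0

/-- `|P(z)|² = 1 + ∑_{-N ≤ k ≤ N, k ≠ 0} a_k z ^ (n_k)` on the circle, with like powers of `z`
collected: the `n_k` are distinct nonzero integers, each of them a difference of two exponents of
`P`, and `n_{-k} = -n_k`, `a_{-k} = conj a_k`. (Only the values of `n` and `a` on `idx N` matter.) -/
structure IsExpansion (P : UnitPolynomial) (N : ℕ) (n : ℤ → ℤ) (a : ℤ → ℂ) : Prop where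
  injOn : Set.InjOn n (idx N : Set ℤ)
  ne_zero : ∀ k ∈ idx N, n k ≠ 0
  exists_sub : ∀ k ∈ idx N, ∃ i l : Fin P.m, n k = (P.R l : ℤ) - (P.R i : ℤ)
  freq_neg : ∀ k ∈ idx N, n (-k) = -n k
  coeff_neg : ∀ k ∈ idx N, a (-k) = conj (a k)
  normSq_eq : ∀ z : Circle,
    ((‖P.eval z‖ ^ 2 : ℝ) : ℂ) = 1 + ∑ k ∈ idx N, a k * (z : ℂ) ^ n k

/-- `L = |P(1)|² - 1`, which is the sum of the `a_k`. -/
noncomputable def L (P : UnitPolynomial) : ℝ := ‖P.eval 1‖ ^ 2 - 1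

/-- The probability measure `ν = |P(z)|² dz`. -/
noncomputable def nu (P : UnitPolynomial) : Measure Circle :=
  dz.withDensity fun z => ENNReal.ofReal (‖P.eval z‖ ^ 2)

/-- The random variable `X(k) = z ^ (n_k) - conj a_k`. -/
noncomputable def X (n : ℤ → ℤ) (a : ℤ → ℂ) (k : ℤ) (z : Circle) : ℂ :=
  (z : ℂ) ^ n k - conj (a k)

/-- The entry `m(k, l) = ∫ X(k) conj X(l) dν` of the correlation matrix. -/
noncomputable def corr (P : UnitPolynomial) (n : ℤ → ℤ) (a : ℤ → ℂ) (k l : ℤ) : ℂ :=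
  ∫ z, X n a k z * conj (X n a l z) ∂P.nu

/-- The sum `r` of all the entries of the correlation matrix; it is real by `ofReal_r`. -/
noncomputable def r (P : UnitPolynomial) (N : ℕ) (n : ℤ → ℤ) (a : ℤ → ℂ) : ℝ :=
  (∑ k ∈ idx N, ∑ l ∈ idx N, P.corr n a k l).re

theorem ofReal_r (P : UnitPolynomial) (N : ℕ) (n : ℤ → ℤ) (a : ℤ → ℂ) :
    ((P.r N n a : ℝ) : ℂ) = ∑ k ∈ idx N, ∑ l ∈ idx N, P.corr n a k l := by
  have hc : ∀ k l, conj (P.corr n a k l) = P.corr n a l k := by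
    intro k l
    unfold corr
    rw [← integral_conj]
    congr 1
    ext z
    simp [mul_comm]
  rw [r, ← Complex.conj_eq_iff_re]
  simp only [map_sum, hc]
  exact Finset.sum_comm

theorem mem_idx {N : ℕ} {k : ℤ} : k ∈ idx N ↔ 1 ≤ k.natAbs ∧ k.natAbs ≤ N := by
  simp only [idx, Finset.mem_erase, Finset.mem_Icc]; omega

/-- Every such polynomial has an expansion, so that `N`, `n_k` and `a_k` exist. -/
theorem exists_isExpansion (P : UnitPolynomial) : ∃ N n a, P.IsExpansion N n a := by
  classical
  set c : Fin P.m → ℂ := fun i => P.ε i * (Real.sqrt (P.p i) : ℂ) with hc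
  set d : Fin P.m × Fin P.m → ℤ := fun x => (P.R x.1 : ℤ) - (P.R x.2 : ℤ) with hd
  set D : Finset ℤ := Finset.univ.image d with hD
  set A : ℤ → ℂ := fun t => ∑ x with d x = t, c x.1 * conj (c x.2) with hA
  set T : Finset ℤ := D.filter (0 < ·) with hT
  have hDneg : ∀ t ∈ D, -t ∈ D := by
    intro t ht
    obtain ⟨x, -, rfl⟩ := Finset.mem_image.1 ht
    exact Finset.mem_image.2 ⟨x.swap, Finset.mem_univ _, by simp [hd]⟩
  have hAneg : ∀ t, A (-t) = conj (A t) := by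
    intro t
    simp only [hA, map_sum, map_mul, Complex.conj_conj]
    refine Finset.sum_nbij' Prod.swap Prod.swap ?_ ?_ ?_ ?_ ?_ <;> simp [hd, mul_comm] <;> grind
  have hA0 : A 0 = 1 := by
    have h1 : A 0 = ∑ i, c i * conj (c i) := by
      simp only [hA]
      refine Finset.sum_nbij' (fun x => x.1) (fun i => (i, i)) ?_ ?_ ?_ ?_ ?_ <;>
        simp [hd, sub_eq_zero]
      · intro i j h; exact P.R_injective h
      · intro i j h; rw [P.R_injective h]; exact Or.inl rfl
    have h2 : ∀ i, c i * conj (c i) = (P.p i : ℂ) := by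
      intro i
      rw [Complex.mul_conj, Complex.normSq_eq_norm_sq]
      simp [hc, P.norm_ε, Real.sq_sqrt (P.p_pos i).le]
    rw [h1, Finset.sum_congr rfl fun i _ => h2 i, ← Complex.ofReal_sum, P.p_sum,
      Complex.ofReal_one]
  have h0D : (0 : ℤ) ∈ D :=
    Finset.mem_image.2 ⟨(⟨0, P.m_pos⟩, ⟨0, P.m_pos⟩), Finset.mem_univ _, by simp [hd]⟩
  have hsq : ∀ z : Circle, ((‖P.eval z‖ ^ 2 : ℝ) : ℂ) = ∑ t ∈ D, A t * (z : ℂ) ^ t := by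
    intro z
    have hz : (z : ℂ) ≠ 0 := z.coe_ne_zero
    rw [← Complex.normSq_eq_norm_sq, ← Complex.mul_conj, eval, map_sum, Finset.sum_mul_sum,
      ← Finset.sum_product', Finset.univ_product_univ,
      ← Finset.sum_fiberwise_of_maps_to (t := D) (g := d)
        (fun x _ => Finset.mem_image_of_mem d (Finset.mem_univ x))]
    refine Finset.sum_congr rfl fun t _ => ?_
    rw [hA, Finset.sum_mul]
    refine Finset.sum_congr rfl fun x hx => ?_
    rw [← (Finset.mem_filter.1 hx).2]
    simp only [hd, hc, map_mul, map_pow, ← Circle.coe_inv_eq_conj, Circle.coe_inv, zpow_sub₀ hz,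
      zpow_natCast]
    simp only [inv_pow, div_eq_mul_inv]
    ring
  set g : ℕ → ℤ := fun i => if h : i - 1 < T.card then T.orderEmbOfFin rfl ⟨i - 1, h⟩ else 0
  have hgT : ∀ i, 1 ≤ i → i ≤ T.card → g i ∈ T := by
    intro i h1 h2
    simp only [g, dif_pos (show i - 1 < T.card by omega)]
    exact Finset.orderEmbOfFin_mem _ _ _
  have hginj : ∀ i j, 1 ≤ i → i ≤ T.card → 1 ≤ j → j ≤ T.card → g i = g j → i = j := by
    intro i j h1 h2 h3 h4 h
    simp only [g, dif_pos (show i - 1 < T.card by omega), dif_pos (show j - 1 < T.card by omega)]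
      at h
    have := (T.orderEmbOfFin rfl).injective h
    simp only [Fin.mk.injEq] at this
    omega
  have hgsurj : ∀ t ∈ T, ∃ i, 1 ≤ i ∧ i ≤ T.card ∧ g i = t := by
    intro t ht
    have : t ∈ Set.range (T.orderEmbOfFin rfl) := by
      rw [Finset.range_orderEmbOfFin]; exact ht
    obtain ⟨i, rfl⟩ := this
    refine ⟨i + 1, by omega, by omega, ?_⟩
    simp [g]
  have hgpos : ∀ i, 1 ≤ i → i ≤ T.card → 0 < g i := fun i h1 h2 =>
    (Finset.mem_filter.1 (hgT i h1 h2)).2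
  set n : ℤ → ℤ := fun k => k.sign * g k.natAbs with hn
  have hnD : ∀ k ∈ idx T.card, n k ∈ D := by
    intro k hk
    rw [mem_idx] at hk
    have := (Finset.mem_filter.1 (hgT _ hk.1 hk.2)).1
    rcases lt_trichotomy k 0 with h | h | h
    · simpa [hn, Int.sign_eq_neg_one_of_neg h] using hDneg _ this
    · simp [h] at hk
    · simpa [hn, Int.sign_eq_one_of_pos h] using this
  have hnne : ∀ k ∈ idx T.card, n k ≠ 0 := by
    intro k hk
    rw [mem_idx] at hk
    refine mul_ne_zero ?_ (hgpos _ hk.1 hk.2).ne'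
    rw [Ne, Int.sign_eq_zero_iff_zero]
    omega
  have hninj : Set.InjOn n (idx T.card : Set ℤ) := by
    intro k hk l hl h
    rw [Finset.mem_coe, mem_idx] at hk hl
    have h1 := hgpos _ hk.1 hk.2
    have h2 := hgpos _ hl.1 hl.2
    have h3 := hginj _ _ hk.1 hk.2 hl.1 hl.2
    simp only [hn] at h
    rcases lt_trichotomy k 0 with hk' | hk' | hk' <;> rcases lt_trichotomy l 0 with hl' | hl' | hl'
      <;> simp only [Int.sign_eq_neg_one_of_neg, Int.sign_eq_one_of_pos, hk', hl', neg_mul, one_mul,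
        Int.sign_zero, zero_mul] at h <;> grind
  have hnimg : (idx T.card).image n = D.erase 0 := by
    ext t
    simp only [Finset.mem_image, Finset.mem_erase]
    constructor
    · rintro ⟨k, hk, rfl⟩
      exact ⟨hnne k hk, hnD k hk⟩
    · rintro ⟨ht0, ht⟩
      rcases lt_or_gt_of_ne ht0 with h | h
      · obtain ⟨i, h1, h2, h3⟩ := hgsurj (-t) (Finset.mem_filter.2 ⟨hDneg t ht, by omega⟩)
        refine ⟨-i, mem_idx.2 (by simpa using ⟨h1, h2⟩), ?_⟩
        have : (-(i : ℤ)).sign = -1 := Int.sign_eq_neg_one_of_neg (by omega)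
        simp only [hn, this, Int.natAbs_neg, Int.natAbs_natCast, h3]; ring
      · obtain ⟨i, h1, h2, h3⟩ := hgsurj t (Finset.mem_filter.2 ⟨ht, h⟩)
        refine ⟨i, mem_idx.2 (by simpa using ⟨h1, h2⟩), ?_⟩
        have : (i : ℤ).sign = 1 := Int.sign_eq_one_of_pos (by omega)
        simp only [hn, this, Int.natAbs_natCast, h3]; ring
  have hnneg : ∀ k, n (-k) = -n k := fun k => by simp [hn]
  refine ⟨T.card, n, fun k => A (n k), hninj, hnne, ?_, fun k _ => hnneg k, ?_, ?_⟩
  · intro k hk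
    obtain ⟨x, -, hx⟩ := Finset.mem_image.1 (hnD k hk)
    exact ⟨x.2, x.1, hx.symm⟩
  · intro k _
    rw [hnneg, hAneg]
  · intro z
    rw [hsq, ← Finset.add_sum_erase _ _ h0D, hA0, ← hnimg, Finset.sum_image hninj]
    simp

end UnitPolynomial

/-!
Write `g = |P|²`, `D = ∑ₖ z ^ nₖ` and `δ = ∫ |g - 1| dz`. Orthogonality of the characters of the
circle gives `∫ |D|² dz = 2N`, `∫ Re D dz = 0` and `∫ Re D · g dz = L`. Since the sum of the `X(k)`
is `D - L`, it follows that `r = ∫ |D - L|² g dz = ∫ |D|² g dz - L²`.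

As `|g - 1| ≤ 1 + g`, the Cauchy–Schwarz inequality applied to `L = ∫ Re D · (g - 1) dz` yields
`L² ≤ (∫ |D|² (1 + g) dz) · δ = (2N + r + L²) δ` (`L_sq_le`). By Scheffé's argument, a.e. convergence
`g → 1` together with `∫ g dz = 1` forces `δ → 0` (`tendsto_integral_abs_sub_one`). When
`N / L² ≤ A` this gives `r / N ≥ (1 / δ - 1) / A - 2`, which tends to infinity.
-/

instance isProbabilityMeasure_dz : IsProbabilityMeasure dz :=
  ⟨by simpa [dz] using Measure.haarMeasure_self (G := Circle) (K₀ := ⊤)⟩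

/-! ### Orthogonality of characters -/

theorem continuous_coe_zpow (m : ℤ) : Continuous fun z : Circle => (z : ℂ) ^ m :=
  continuous_iff_continuousAt.2 fun z =>
    (Continuous.continuousAt (by fun_prop)).zpow₀ m (Or.inl z.coe_ne_zero)

theorem integrable_dz_of_continuous {E : Type*} [NormedAddCommGroup E] {f : Circle → E}
    (hf : Continuous f) : Integrable f dz :=
  hf.integrable_of_hasCompactSupport (HasCompactSupport.of_compactSpace f)

theorem integral_coe_zpow (m : ℤ) : ∫ z : Circle, (z : ℂ) ^ m ∂dz = if m = 0 then 1 else 0 := by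
  split_ifs with hm
  · simp [hm]
  · have : dz.IsMulLeftInvariant := by unfold dz; infer_instance
    -- translation by a point `w` with `w ^ m = -1` changes the sign of the integral
    set w : Circle := Circle.exp (Real.pi / m) with hw
    have hwm : (w : ℂ) ^ m = -1 := by
      rw [hw, Circle.coe_exp, ← Complex.exp_int_mul]
      have : (m : ℂ) ≠ 0 := by exact_mod_cast hm
      rw [← Complex.exp_pi_mul_I]
      congr 1
      push_cast
      field_simp
    have h := integral_mul_left_eq_self (μ := dz) (fun z : Circle => (z : ℂ) ^ m) w
    simp only [Circle.coe_mul, mul_zpow, hwm, neg_mul, one_mul, integral_neg] at h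
    linear_combination (-1 / 2 : ℂ) * h

namespace UnitPolynomial

theorem continuous_eval (P : UnitPolynomial) : Continuous P.eval := by
  unfold eval; fun_prop

theorem integral_nu {E : Type*} [NormedAddCommGroup E] [NormedSpace ℝ E] (P : UnitPolynomial)
    (f : Circle → E) : ∫ z, f z ∂P.nu = ∫ z, ‖P.eval z‖ ^ 2 • f z ∂dz := by
  rw [nu, integral_withDensity_eq_integral_toReal_smul]
  · simp
  · have := P.continuous_eval
    exact (ENNReal.continuous_ofReal.comp (this.norm.pow 2)).measurable
  · simp

/-- The sum `D = ∑ₖ z ^ nₖ` of the frequencies occurring in the expansion. -/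
noncomputable def freqSum (N : ℕ) (n : ℤ → ℤ) (z : Circle) : ℂ := ∑ k ∈ idx N, (z : ℂ) ^ n k

theorem continuous_freqSum (N : ℕ) (n : ℤ → ℤ) : Continuous (freqSum N n) :=
  continuous_finsetSum _ fun _ _ => continuous_coe_zpow _

theorem conj_freqSum (N : ℕ) (n : ℤ → ℤ) (z : Circle) :
    conj (freqSum N n z) = ∑ k ∈ idx N, (z : ℂ) ^ (-n k) := by
  simp only [freqSum, map_sum, map_zpow₀, ← Circle.coe_inv_eq_conj, Circle.coe_inv, inv_zpow',
    zpow_neg]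

theorem card_idx (N : ℕ) : (idx N).card = 2 * N := by
  rw [idx, Finset.card_erase_of_mem (by simp), Int.card_Icc]
  omega

theorem integral_conj_freqSum_mul_sum {N : ℕ} {n : ℤ → ℤ} (hn : Set.InjOn n (idx N : Set ℤ))
    (b : ℤ → ℂ) :
    ∫ z, conj (freqSum N n z) * ∑ l ∈ idx N, b l * (z : ℂ) ^ n l ∂dz = ∑ k ∈ idx N, b k := by
  have h : ∀ z : Circle, conj (freqSum N n z) * ∑ l ∈ idx N, b l * (z : ℂ) ^ n l =
      ∑ k ∈ idx N, ∑ l ∈ idx N, b l * (z : ℂ) ^ (n l - n k) := by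
    intro z
    rw [conj_freqSum, Finset.sum_mul_sum]
    refine Finset.sum_congr rfl fun k _ => Finset.sum_congr rfl fun l _ => ?_
    rw [sub_eq_add_neg, zpow_add₀ z.coe_ne_zero]
    ring
  have hi : ∀ k l, Integrable (fun z : Circle => b l * (z : ℂ) ^ (n l - n k)) dz := fun k l =>
    integrable_dz_of_continuous (continuous_const.mul (continuous_coe_zpow _))
  simp only [h]
  rw [integral_finsetSum _ fun k _ => integrable_finsetSum _ fun l _ => hi k l]
  refine Finset.sum_congr rfl fun k hk => ?_
  rw [integral_finsetSum _ fun l _ => hi k l, Finset.sum_eq_single_of_mem k hk]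
  · simp
  · intro l hl hlk
    have : n l - n k ≠ 0 := fun h => hlk (hn hl hk (sub_eq_zero.1 h))
    simp [integral_const_mul, integral_coe_zpow, this]

theorem integral_norm_freqSum_sq {N : ℕ} {n : ℤ → ℤ} (hn : Set.InjOn n (idx N : Set ℤ)) :
    ∫ z, ‖freqSum N n z‖ ^ 2 ∂dz = 2 * N := by
  have h := integral_conj_freqSum_mul_sum hn fun _ => 1
  have h2 : ∀ z, conj (freqSum N n z) * ∑ l ∈ idx N, 1 * (z : ℂ) ^ n l =
      ((‖freqSum N n z‖ ^ 2 : ℝ) : ℂ) := by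
    intro z
    simp only [one_mul]
    rw [← freqSum, mul_comm, Complex.mul_conj, Complex.normSq_eq_norm_sq]
  simp only [h2] at h
  rw [integral_complex_ofReal, Finset.sum_const, card_idx] at h
  simp only [nsmul_eq_mul, mul_one] at h
  exact_mod_cast h

/-! ### Integrals against an expansion -/

namespace IsExpansion

variable {P : UnitPolynomial} {N : ℕ} {n : ℤ → ℤ} {a : ℤ → ℂ}

theorem sum_coeff (h : P.IsExpansion N n a) : ∑ k ∈ idx N, a k = (P.L : ℂ) := by
  have h1 := h.normSq_eq 1
  simp only [Circle.coe_one, one_zpow, mul_one] at h1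
  rw [L]
  push_cast at h1 ⊢
  rw [h1]
  ring

theorem integral_normSq (h : P.IsExpansion N n a) : ∫ z, ‖P.eval z‖ ^ 2 ∂dz = 1 := by
  have hi : ∀ k, Integrable (fun z : Circle => a k * (z : ℂ) ^ n k) dz := fun k =>
    integrable_dz_of_continuous (continuous_const.mul (continuous_coe_zpow _))
  have h1 : ((∫ z, ‖P.eval z‖ ^ 2 ∂dz : ℝ) : ℂ) = 1 := by
    rw [← integral_complex_ofReal]
    simp only [h.normSq_eq]
    rw [integral_add (integrable_const _) (integrable_finsetSum _ fun k _ => hi k),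
      integral_finsetSum _ fun k _ => hi k, Finset.sum_eq_zero]
    · simp
    · intro k hk
      simp [integral_const_mul, integral_coe_zpow, h.ne_zero k hk]
  exact_mod_cast h1

theorem integral_re_freqSum_mul_sub_one (h : P.IsExpansion N n a) :
    ∫ z, (freqSum N n z).re * (‖P.eval z‖ ^ 2 - 1) ∂dz = P.L := by
  have h1 := integral_conj_freqSum_mul_sum h.injOn a
  have h2 : ∀ z : Circle, ∑ l ∈ idx N, a l * (z : ℂ) ^ n l = ((‖P.eval z‖ ^ 2 - 1 : ℝ) : ℂ) := by
    intro z
    have := h.normSq_eq z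
    push_cast at this ⊢
    rw [this]
    ring
  simp only [h2, h.sum_coeff] at h1
  have hc := P.continuous_eval
  have hD := continuous_freqSum N n
  have hint : Integrable
      (fun z => conj (freqSum N n z) * ((‖P.eval z‖ ^ 2 - 1 : ℝ) : ℂ)) dz :=
    integrable_dz_of_continuous (by fun_prop)
  have h3 := integral_re hint
  have h4 : ∀ z, RCLike.re (conj (freqSum N n z) * ((‖P.eval z‖ ^ 2 - 1 : ℝ) : ℂ)) =
      (freqSum N n z).re * (‖P.eval z‖ ^ 2 - 1) := fun z => by
    rw [RCLike.re_eq_complex_re, Complex.re_mul_ofReal, Complex.conj_re]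
  simpa only [h1, h4, RCLike.re_eq_complex_re, Complex.ofReal_re] using h3

theorem integral_re_freqSum (h : P.IsExpansion N n a) :
    ∫ z, (freqSum N n z).re ∂dz = 0 := by
  have hi : ∀ k, Integrable (fun z : Circle => (z : ℂ) ^ n k) dz := fun k =>
    integrable_dz_of_continuous (continuous_coe_zpow _)
  have h0 : ∫ z, freqSum N n z ∂dz = 0 := by
    simp only [freqSum]
    rw [integral_finsetSum _ fun k _ => hi k, Finset.sum_eq_zero]
    intro k hk
    simp [integral_coe_zpow, h.ne_zero k hk]
  have h3 := integral_re (integrable_dz_of_continuous (continuous_freqSum N n))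
  simpa [h0] using h3

theorem sum_X (h : P.IsExpansion N n a) (z : Circle) :
    ∑ k ∈ idx N, X n a k z = freqSum N n z - P.L := by
  simp only [X, Finset.sum_sub_distrib, ← map_sum, h.sum_coeff, Complex.conj_ofReal, freqSum]

theorem r_eq_integral (h : P.IsExpansion N n a) :
    P.r N n a = ∫ z, ‖freqSum N n z - P.L‖ ^ 2 * ‖P.eval z‖ ^ 2 ∂dz := by
  have hc := P.continuous_eval
  have hX : ∀ k, Continuous (X n a k) := fun k => (continuous_coe_zpow _).sub continuous_const
  have hi : ∀ k l, Integrable (fun z => ‖P.eval z‖ ^ 2 • (X n a k z * conj (X n a l z))) dz := by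
    intro k l
    have h1 := hX k
    have h2 := hX l
    exact integrable_dz_of_continuous (by fun_prop)
  have key : ((P.r N n a : ℝ) : ℂ) =
      ((∫ z, ‖freqSum N n z - P.L‖ ^ 2 * ‖P.eval z‖ ^ 2 ∂dz : ℝ) : ℂ) := by
    rw [ofReal_r, ← integral_complex_ofReal]
    simp only [corr, integral_nu]
    simp_rw [← integral_finsetSum _ fun l _ => hi _ l]
    rw [← integral_finsetSum _ fun k _ => integrable_finsetSum _ fun l _ => hi k l]
    refine integral_congr_ae (Eventually.of_forall fun z => ?_)
    simp only [← Finset.smul_sum, ← Finset.mul_sum, ← Finset.sum_mul, ← map_sum, h.sum_X]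
    rw [Complex.mul_conj, Complex.normSq_eq_norm_sq, Complex.real_smul]
    push_cast
    ring
  exact_mod_cast key

theorem r_eq_sub (h : P.IsExpansion N n a) :
    P.r N n a = ∫ z, ‖freqSum N n z‖ ^ 2 * ‖P.eval z‖ ^ 2 ∂dz - P.L ^ 2 := by
  have hc := P.continuous_eval
  have hD := continuous_freqSum N n
  have hre : Continuous fun z => (freqSum N n z).re := Complex.continuous_re.comp hD
  have e : ∀ z, ‖freqSum N n z - P.L‖ ^ 2 * ‖P.eval z‖ ^ 2 =
      ‖freqSum N n z‖ ^ 2 * ‖P.eval z‖ ^ 2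
        - 2 * P.L * ((freqSum N n z).re * (‖P.eval z‖ ^ 2 - 1))
        - 2 * P.L * (freqSum N n z).re + P.L ^ 2 * ‖P.eval z‖ ^ 2 := by
    intro z
    simp only [← Complex.normSq_eq_norm_sq (freqSum N n z - _),
      ← Complex.normSq_eq_norm_sq (freqSum N n z), Complex.normSq_apply, Complex.sub_re,
      Complex.sub_im, Complex.ofReal_re, Complex.ofReal_im]
    ring
  rw [h.r_eq_integral]
  simp only [e]
  rw [integral_add, integral_sub, integral_sub, integral_const_mul, integral_const_mul,
    integral_const_mul, h.integral_normSq, h.integral_re_freqSum,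
    h.integral_re_freqSum_mul_sub_one]
  · ring
  all_goals exact integrable_dz_of_continuous (by fun_prop)

/-- The Cauchy–Schwarz bound for `L = ∫ Re D · (g - 1) dz`, with `D` weighted by `1 + g`. -/
theorem L_sq_le (h : P.IsExpansion N n a) :
    P.L ^ 2 ≤ (2 * N + P.r N n a + P.L ^ 2) * ∫ z, |‖P.eval z‖ ^ 2 - 1| ∂dz := by
  have hc := P.continuous_eval
  have hD := continuous_freqSum N n
  have hre : Continuous fun z => (freqSum N n z).re := Complex.continuous_re.comp hD
  set δ := ∫ z, |‖P.eval z‖ ^ 2 - 1| ∂dz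
  have hQ : ∫ z, ‖freqSum N n z‖ ^ 2 * (1 + ‖P.eval z‖ ^ 2) ∂dz =
      2 * N + P.r N n a + P.L ^ 2 := by
    simp only [mul_add, mul_one]
    rw [integral_add, integral_norm_freqSum_sq h.injOn, h.r_eq_sub]
    · ring
    all_goals exact integrable_dz_of_continuous (by fun_prop)
  -- the integral of a pointwise nonnegative quadratic in `x` has nonpositive discriminant
  have hquad : ∀ x : ℝ,
      0 ≤ (2 * N + P.r N n a + P.L ^ 2) * (x * x) + (-2 * P.L) * x + δ := by
    intro x
    have hpt : ∀ z, 0 ≤ (x * x) * (‖freqSum N n z‖ ^ 2 * (1 + ‖P.eval z‖ ^ 2))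
        + (-2 * x) * ((freqSum N n z).re * (‖P.eval z‖ ^ 2 - 1)) + |‖P.eval z‖ ^ 2 - 1| := by
      intro z
      have hd : (freqSum N n z).re ^ 2 ≤ ‖freqSum N n z‖ ^ 2 := by
        rw [← sq_abs]
        exact pow_le_pow_left₀ (abs_nonneg _) (Complex.abs_re_le_norm _) 2
      generalize (freqSum N n z).re = d at *
      generalize ‖freqSum N n z‖ ^ 2 = q at *
      have hg : 0 ≤ ‖P.eval z‖ ^ 2 := by positivity
      generalize ‖P.eval z‖ ^ 2 = g at *
      have hg1 : |g - 1| ≤ 1 + g := abs_le.2 ⟨by linarith, by linarith⟩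
      have h1 : x * x * (d ^ 2 * |g - 1|) ≤ x * x * (q * (1 + g)) := by
          have := mul_le_mul hd hg1 (abs_nonneg _) ((sq_nonneg d).trans hd)
          exact mul_le_mul_of_nonneg_left this (mul_self_nonneg x)
      have h2 : x * d * (g - 1) ≤ |x * d| * |g - 1| := by
        rw [← abs_mul]; exact le_abs_self _
      have h3 : 0 ≤ |g - 1| * (|x * d| - 1) ^ 2 := by positivity
      have h4 : |x * d| ^ 2 = (x * d) ^ 2 := sq_abs _
      nlinarith
    have hint := integral_nonneg (μ := dz) (Pi.le_def.2 hpt)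
    rw [integral_add, integral_add, integral_const_mul, integral_const_mul, hQ,
      h.integral_re_freqSum_mul_sub_one] at hint
    · linarith
    all_goals exact integrable_dz_of_continuous (by fun_prop)
  have hdisc := discrim_le_zero hquad
  rw [discrim] at hdisc
  linarith

theorem pos_of_L_ne_zero (h : P.IsExpansion N n a) (hL : P.L ≠ 0) : 0 < N := by
  rcases Nat.eq_zero_or_pos N with rfl | hN
  · refine absurd ?_ hL
    have := h.sum_coeff
    simpa [idx] using this.symm
  · exact hN

end IsExpansion

end UnitPolynomial

/-! ### Flatness and convergence in mean -/

/-- Scheffé's lemma for densities tending to `1`. -/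
theorem tendsto_integral_abs_sub_one {α : Type*} [MeasurableSpace α] {μ : Measure α}
    [IsProbabilityMeasure μ] {g : ℕ → α → ℝ} (hg : ∀ j, Integrable (g j) μ)
    (hg0 : ∀ j z, 0 ≤ g j z) (hg1 : ∀ j, ∫ z, g j z ∂μ = 1)
    (hlim : ∀ᵐ z ∂μ, Tendsto (fun j => g j z) atTop (𝓝 1)) :
    Tendsto (fun j => ∫ z, |g j z - 1| ∂μ) atTop (𝓝 0) := by
  have hi : ∀ j, Integrable (fun z => 1 - g j z) μ := fun j => (integrable_const _).sub (hg j)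
  -- `1 - g` has mean `0`, so its `L¹` norm is twice the integral of its positive part,
  -- which is dominated by `1`
  have e : ∀ j, ∫ z, |g j z - 1| ∂μ = 2 * ∫ z, max (1 - g j z) 0 ∂μ := by
    intro j
    have h1 : ∀ z, |g j z - 1| = 2 * max (1 - g j z) 0 - (1 - g j z) := by
      intro z
      rcases le_total (g j z) 1 with h | h
      · rw [abs_of_nonpos (by linarith), max_eq_left (by linarith)]; ring
      · rw [abs_of_nonneg (by linarith), max_eq_right (by linarith)]; ring
    simp only [h1]
    rw [integral_sub ((hi j).pos_part.const_mul 2) (hi j),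
      integral_sub (integrable_const _) (hg j), integral_const_mul, hg1]
    simp
  have h0 : Tendsto (fun j => ∫ z, max (1 - g j z) 0 ∂μ) atTop (𝓝 (∫ _, (0 : ℝ) ∂μ)) := by
    refine tendsto_integral_of_dominated_convergence (fun _ => 1)
      (fun j => (hi j).pos_part.aestronglyMeasurable) (integrable_const _) ?_ ?_
    · intro j
      filter_upwards with z
      rw [Real.norm_of_nonneg (le_max_right _ _)]
      exact max_le (by linarith [hg0 j z]) zero_le_one
    · filter_upwards [hlim] with z hz
      simpa using (tendsto_const_nhds (x := (1 : ℝ)).sub hz).max (tendsto_const_nhds (x := (0 : ℝ)))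
  simp only [e]
  simpa using h0.const_mul 2

theorem theorem4p1 (P : ℕ → UnitPolynomial)
    (N : ℕ → ℕ) (n : ℕ → ℤ → ℤ) (a : ℕ → ℤ → ℂ)
    (hexp : ∀ j, (P j).IsExpansion (N j) (n j) (a j))
    (hL : ∀ j, (P j).L ≠ 0)
    (hbdd : ∃ A : ℝ, ∀ j, (N j : ℝ) / (P j).L ^ 2 ≤ A)
    (hflat : ∀ᵐ z ∂dz, Tendsto (fun j => ‖(P j).eval z‖) atTop (𝓝 1)) :
    Tendsto (fun j => (P j).r (N j) (n j) (a j) / (N j : ℝ)) atTop atTop := by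
  obtain ⟨A, hA⟩ := hbdd
  have hN : ∀ j, (0 : ℝ) < N j := fun j => by
    exact_mod_cast (hexp j).pos_of_L_ne_zero (hL j)
  have hL2 : ∀ j, 0 < (P j).L ^ 2 := fun j => by have := hL j; positivity
  have hA0 : 0 < A := (div_pos (hN 0) (hL2 0)).trans_le (hA 0)
  set δ : ℕ → ℝ := fun j => ∫ z, |‖(P j).eval z‖ ^ 2 - 1| ∂dz with hδ
  have hδ0 : Tendsto δ atTop (𝓝 0) := by
    refine tendsto_integral_abs_sub_one
      (fun j => integrable_dz_of_continuous ((P j).continuous_eval.norm.pow 2))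
      (fun j z => by positivity) (fun j => (hexp j).integral_normSq) ?_
    filter_upwards [hflat] with z hz
    simpa using hz.pow 2
  have hkey : ∀ j, (P j).L ^ 2 ≤
      (2 * N j + (P j).r (N j) (n j) (a j) + (P j).L ^ 2) * δ j := fun j => (hexp j).L_sq_le
  have hδpos : ∀ j, 0 < δ j := by
    intro j
    have h0 : 0 ≤ δ j := integral_nonneg fun z => abs_nonneg _
    refine h0.lt_of_ne fun h => ?_
    have := hkey j
    rw [← h, mul_zero] at this
    exact (hL2 j).not_ge this
  have hδinv : Tendsto (fun j => (δ j)⁻¹) atTop atTop :=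
    (tendsto_nhdsWithin_iff.2 ⟨hδ0, Eventually.of_forall hδpos⟩).inv_tendsto_nhdsGT_zero
  have hlow : Tendsto (fun j => A⁻¹ * ((δ j)⁻¹ - 1) - 2) atTop atTop :=
    tendsto_atTop_add_const_right _ (-2)
      ((tendsto_atTop_add_const_right _ (-1) hδinv).const_mul_atTop (inv_pos.2 hA0))
  refine tendsto_atTop_mono' _ ?_ hlow
  filter_upwards [hδ0.eventually_le_const one_pos] with j hj
  have h1 : (0 : ℝ) ≤ (δ j)⁻¹ - 1 := sub_nonneg.2 ((one_le_inv₀ (hδpos j)).2 hj)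
  have h2 : (P j).L ^ 2 * (δ j)⁻¹ ≤ 2 * N j + (P j).r (N j) (n j) (a j) + (P j).L ^ 2 := by
    rw [← div_eq_mul_inv, div_le_iff₀ (hδpos j)]
    exact hkey j
  have h3 : A⁻¹ * N j ≤ (P j).L ^ 2 := by
    rw [inv_mul_le_iff₀ hA0, ← div_le_iff₀ (hL2 j)]
    exact hA j
  rw [le_div_iff₀ (hN j)]
  have h4 := mul_le_mul_of_nonneg_right h3 h1
  linarith
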